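/- Let $(M,\omega,\theta)$ be an exact symplectic manifold, i.e. $M$ is a smooth finite-dimensional manifold without boundary, $\omega$ is a smooth closed nondegenerate $2$-form on $M$, and $\theta$ is a smooth $1$-form on $M$ with $\omega=-d\theta$. Let $\Phi:\mathbb R^+\times M\to M$ be a smooth action of the multiplicative group $\mathbb R^+$ of positive real numbers, write $\Phi_g=\Phi(g,\cdot)$, and for $\xi\in\mathbb R$ (the Lie algebra of $\mathbb R^+$, with the usual exponential as exponential map) let $$\xi_M(x)=\frac{d}{d\tau}\Big|_{\tau=0}\Phi_{e^{\tau\xi}}(x)$$ be the infinitesimal generator of the action corresponding to $\xi$. Let $c\in\mathbb R$ and suppose that $\Phi_g^*\theta=g^c\theta$ for all $g\in\mathbb R^+$. Then there is a function $J:M\to\mathbb R$ (where $\mathbb R$ is identified with the dual of the Lie algebra) such that $$J_\xi:=\xi J=i_{\xi_M}\theta\qquad\text{for all }\xi\in\mathbb R,$$ and $J$ is a conformal momentum map with parameter $c$ for $\Phi$. That is: the action is conformally symplectic with parameter $c$, meaning $\Phi_g^*\omega=g^c\omega$ for all $g\in\mathbb R^+$; $J$ is smooth; and $$i_{\xi_M}\omega+(c\,\xi)\,\theta=dJ_\xi\qquad\text{for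 all }\xi\in\mathbb R .$$ -/

import Mathlib

open scoped Manifold ContDiff

noncomputable section

/-! ### Differential forms on a smooth manifold without boundary, modelled on `E` -/

/-- A (not necessarily smooth) differential `k`-form on `M`: an alternating `k`-linear form on
each tangent space. -/
abbrev DiffForm (E : Type*) [NormedAddCommGroup E] [NormedSpace ℝ E]
    (M : Type*) [TopologicalSpace M] [ChartedSpace E M] (k : ℕ) : Type _ :=
  (x : M) → (TangentSpace 𝓘(ℝ, E) x) [⋀^Fin k]→L[ℝ] ℝ

/-- A (not necessarily smooth) vector field on `M`. -/
abbrev VecField (E : Type*) [NormedAddCommGroup E] [NormedSpace ℝ E]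
    (M : Type*) [TopologicalSpace M] [ChartedSpace E M] : Type _ :=
  (x : M) → TangentSpace 𝓘(ℝ, E) x

namespace DiffForm

variable {E : Type*} [NormedAddCommGroup E] [NormedSpace ℝ E]
  {M : Type*} [TopologicalSpace M] [ChartedSpace E M] {k : ℕ}

/-- The expression of a form in the chart `φ` at `x₀`: its pullback along `φ⁻¹`. It is meaningful on
the target of the chart. -/
def chartRep (α : DiffForm E M k) (x₀ : M) : E → E [⋀^Fin k]→L[ℝ] ℝ := fun y =>
  (α ((extChartAt 𝓘(ℝ, E) x₀).symm y)).compContinuousLinearMap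
    (mfderiv 𝓘(ℝ, E) 𝓘(ℝ, E) (extChartAt 𝓘(ℝ, E) x₀).symm y)

/-- A form is smooth if it is smooth in charts. -/
def IsSmooth (α : DiffForm E M k) : Prop :=
  ∀ x₀ : M, ContDiffOn ℝ ∞ (α.chartRep x₀) (extChartAt 𝓘(ℝ, E) x₀).target

/-- The exterior derivative: at `x`, take the exterior derivative of the expression of the form in
the chart `φ` at `x`, and pull the result back along `φ`. -/
def extD (α : DiffForm E M k) : DiffForm E M (k + 1) := fun x =>
  (extDeriv (α.chartRep x) (extChartAt 𝓘(ℝ, E) x x)).compContinuousLinearMap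
    (mfderiv 𝓘(ℝ, E) 𝓘(ℝ, E) (extChartAt 𝓘(ℝ, E) x) x)

/-- The pullback `f^* α` of a form along a map `f : M → M`. -/
def pullback (f : M → M) (α : DiffForm E M k) : DiffForm E M k := fun x =>
  (α (f x)).compContinuousLinearMap (mfderiv 𝓘(ℝ, E) 𝓘(ℝ, E) f x)

/-- The interior product `i_X α = α(X, ·, …, ·)`. -/
def interior (X : VecField E M) (α : DiffForm E M (k + 1)) : DiffForm E M k := fun x =>
  ContinuousAlternatingMap.curryLeft (E := E) (α x) (X x)

/-- The function corresponding to a `0`-form. -/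
def toFun (α : DiffForm E M 0) : M → ℝ := fun x => α x ![]

/-- The differential `dF` of a function, as a `1`-form. -/
def differential (F : M → ℝ) : DiffForm E M 1 := fun x =>
  ContinuousAlternatingMap.ofSubsingleton ℝ (TangentSpace 𝓘(ℝ, E) x) ℝ (0 : Fin 1)
    (mfderiv 𝓘(ℝ, E) 𝓘(ℝ, ℝ) F x)

theorem interior_apply (X : VecField E M) (α : DiffForm E M (k + 1)) (x : M)
    (v : Fin k → TangentSpace 𝓘(ℝ, E) x) :
    interior X α x v = α x (Matrix.vecCons (X x) v) := rfl

theorem differential_apply (F : M → ℝ) (x : M) (v : Fin 1 → TangentSpace 𝓘(ℝ, E) x) :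
    differential F x v = mfderiv 𝓘(ℝ, E) 𝓘(ℝ, ℝ) F x (v 0) := rfl

end DiffForm

/-- `(M, Ω, θ)` is an exact symplectic manifold: `Ω` is a symplectic form (a smooth, closed,
nondegenerate `2`-form) and `θ` is a smooth `1`-form with `Ω = -dθ`. -/
structure IsExactSymplectic {E : Type*} [NormedAddCommGroup E] [NormedSpace ℝ E]
    {M : Type*} [TopologicalSpace M] [ChartedSpace E M]
    (Ω : DiffForm E M 2) (θ : DiffForm E M 1) : Prop where
  smooth_form : Ω.IsSmooth
  closed : Ω.extD = 0
  nondegenerate : ∀ (x : M) (v : TangentSpace 𝓘(ℝ, E) x), (∀ w, Ω x ![v, w] = 0) → v = 0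
  smooth_primitive : θ.IsSmooth
  eq_neg_extD : Ω = -θ.extD

/-! ### The multiplicative Lie group of positive real numbers -/

/-- The positive real numbers as an open subset of `ℝ`. -/
def posReals : TopologicalSpace.Opens ℝ := ⟨Set.Ioi 0, isOpen_Ioi⟩

/-- The group `ℝ⁺`; its manifold structure is that of an open subset of `ℝ`. -/
abbrev PosReal : Type := ↥posReals

/-- Multiplication of positive real numbers. -/
instance instCommGroupPosReal : CommGroup PosReal :=
  inferInstanceAs (CommGroup {x : ℝ // 0 < x})

namespace PosReal

theorem coe_mul (g h : PosReal) : ((g * h : PosReal) : ℝ) = (g : ℝ) * (h : ℝ) := rfl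

theorem coe_one : ((1 : PosReal) : ℝ) = 1 := rfl

theorem coe_pos (g : PosReal) : 0 < (g : ℝ) := g.2

/-- The exponential map from the Lie algebra `ℝ` of `ℝ⁺` to `ℝ⁺`. -/
def exp (t : ℝ) : PosReal := ⟨Real.exp t, Real.exp_pos t⟩

end PosReal

/-! ### Actions of `ℝ⁺` and conformal momentum maps -/

section Action

variable {E : Type*} [NormedAddCommGroup E] [NormedSpace ℝ E]
  {M : Type*} [TopologicalSpace M] [ChartedSpace E M] [MulAction PosReal M]

variable (E) in
/-- The infinitesimal generator `ξ_M(x) = d/dτ|_{τ=0} Φ_{exp(τξ)}(x)` of the action. The velocity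
lives in the tangent space at `Φ_{exp(0)}(x) = x`. -/
def infinitesimalGenerator (ξ : ℝ) : VecField E M := fun x =>
  (mfderiv 𝓘(ℝ, ℝ) 𝓘(ℝ, E) (fun τ : ℝ => PosReal.exp (τ * ξ) • x) 0 (1 : ℝ) : E)

/-- The action scales the form `α` with exponent `c`: `Φ_g^* α = g^c α` for all `g ∈ ℝ⁺`. -/
def ScalesForm {k : ℕ} (c : ℝ) (α : DiffForm E M k) : Prop :=
  ∀ g : PosReal, DiffForm.pullback (fun x : M => g • x) α = ((g : ℝ) ^ c) • α

/-- The action is conformally symplectic with parameter `c`: `Φ_g^* Ω = g^c Ω` for all `g ∈ ℝ⁺`. -/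
def IsConformallySymplecticAction (c : ℝ) (Ω : DiffForm E M 2) : Prop :=
  ScalesForm c Ω

/-- The function `J_ξ = ⟨J, ξ⟩ = ξ J`, where `J` takes values in the dual `ℝ` of the Lie algebra
`ℝ`. -/
def momentumFunction (J : M → ℝ) (ξ : ℝ) : M → ℝ := fun x => ξ * J x

/-- `J` is a conformal momentum map with parameter `c`: the action is conformally symplectic with
parameter `c`, `J` is smooth, and `i_{ξ_M} Ω + (c ξ) θ = dJ_ξ` for all `ξ`. -/
structure IsConformalMomentumMap (c : ℝ) (Ω : DiffForm E M 2) (θ : DiffForm E M 1)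
    (J : M → ℝ) : Prop where
  conformallySymplectic : IsConformallySymplecticAction c Ω
  smooth : ContMDiff 𝓘(ℝ, E) 𝓘(ℝ, ℝ) ∞ J
  momentum_eq : ∀ ξ : ℝ,
    DiffForm.interior (infinitesimalGenerator E ξ) Ω + (c * ξ) • θ =
      DiffForm.differential (momentumFunction J ξ)

end Action

end

/-! Take `J` to be the contraction of `θ` with the generator of `ξ = 1`; since the generator is
linear in `ξ`, `ξ J` is the contraction with `ξ_M`. Because `d` commutes with pullback, `Φ_g^* θ =
g^c θ` gives `Φ_g^* dθ = g^c dθ`, so the action is conformally symplectic.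

Differentiating `Φ_{exp(tξ)}^* θ = e^{tcξ} θ` at `t = 0` says that the Lie derivative of `θ` along
`ξ_M` is `cξ θ`. By Cartan's formula this reads `i_{ξ_M} dθ + d(i_{ξ_M} θ) = cξ θ`, which is the
momentum equation once `dθ = -Ω`.

Cartan's formula is proved directly for a scaled `1`-form: `extDeriv_add_fderiv_of_scaling` is the
computation in a vector space, needing only a `C^2` family `Ψ(t, ·)` that is the identity at `t =
0`, and `ScalesForm.cartan` transfers it through charts. -/

open scoped Topology

noncomputable section

/-! ### Cartan's formula in a vector space -/

section Local

variable {E : Type*} [NormedAddCommGroup E] [NormedSpace ℝ E]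

/-- Cartan's formula, in a vector space, for a `1`-form scaled by a local one-parameter family of
diffeomorphisms. -/
theorem extDeriv_add_fderiv_of_scaling {Θ : E → E [⋀^Fin 1]→L[ℝ] ℝ} {Ψ : ℝ × E → E} {y₀ : E}
    {a : ℝ} (hΘ : DifferentiableAt ℝ Θ y₀) (hΨ : ContDiffAt ℝ 2 Ψ (0, y₀))
    (hΨ₀ : ∀ᶠ y in 𝓝 y₀, Ψ (0, y) = y)
    (hscale : ∀ᶠ t in 𝓝 (0 : ℝ), ∀ v : E,
      Θ (Ψ (t, y₀)) ![fderiv ℝ Ψ (t, y₀) (0, v)] = Real.exp (t * a) * Θ y₀ ![v]) (v : E) :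
    extDeriv Θ y₀ ![fderiv ℝ Ψ (0, y₀) (1, 0), v] +
      fderiv ℝ (fun y => Θ y ![fderiv ℝ Ψ (0, y) (1, 0)]) y₀ v = a * Θ y₀ ![v] := by
  -- Viewing `1`-forms as covectors makes the product rule `HasFDerivAt.clm_apply` available.
  let ev : (E [⋀^Fin 1]→L[ℝ] ℝ) →L[ℝ] (E →L[ℝ] ℝ) :=
    ((ContinuousAlternatingMap.ofSubsingletonLIE (𝕜 := ℝ) (E := E) (F := ℝ)
      (0 : Fin 1)).symm.toContinuousLinearEquiv : (E [⋀^Fin 1]→L[ℝ] ℝ) →L[ℝ] (E →L[ℝ] ℝ))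
  have hev (α : E [⋀^Fin 1]→L[ℝ] ℝ) (w : E) : α ![w] = ev α w := by
    change α ![w] = α (fun _ => w)
    congr 1
    ext i
    simp
  set T' : E →L[ℝ] (E →L[ℝ] ℝ) := ev.comp (fderiv ℝ Θ y₀) with hT'
  set D' := fderiv ℝ (fderiv ℝ Ψ) (0, y₀) with hD'
  have hΨy : Ψ (0, y₀) = y₀ := hΨ₀.self_of_nhds
  have hT : HasFDerivAt (fun y => ev (Θ y)) T' y₀ := ev.hasFDerivAt.comp y₀ hΘ.hasFDerivAt
  have hD : HasFDerivAt (fderiv ℝ Ψ) D' (0, y₀) :=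
    ((hΨ.fderiv_right (m := 1) (by norm_num)).differentiableAt (by simp)).hasFDerivAt
  have hΨ' : HasFDerivAt Ψ (fderiv ℝ Ψ (0, y₀)) (0, y₀) :=
    (hΨ.differentiableAt (by simp)).hasFDerivAt
  -- Mixed partials of `Ψ` commute, so the second-derivative terms of `htime` and `hspace` agree.
  have hsymm : D' (1, 0) (0, v) = D' (0, v) (1, 0) := (hΨ.isSymmSndFDerivAt (by simp)) _ _
  have hl : HasFDerivAt (fun t : ℝ => (t, y₀)) (ContinuousLinearMap.inl ℝ ℝ E) 0 :=
    hasFDerivAt_prodMk_left 0 y₀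
  have hr : HasFDerivAt (fun y : E => ((0 : ℝ), y)) (ContinuousLinearMap.inr ℝ ℝ E) y₀ :=
    hasFDerivAt_prodMk_right 0 y₀
  have hid : fderiv ℝ Ψ (0, y₀) (0, v) = v := by
    have h₁ := hΨ'.comp y₀ hr
    have h₂ : HasFDerivAt (Ψ ∘ fun y : E => ((0 : ℝ), y)) (ContinuousLinearMap.id ℝ E) y₀ :=
      (hasFDerivAt_id y₀).congr_of_eventuallyEq hΨ₀
    simpa using congrArg (fun A : E →L[ℝ] E => A v) (h₁.unique h₂)
  -- The scaling law differentiated in `t` at `0`.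
  have htime : T' (fderiv ℝ Ψ (0, y₀) (1, 0)) v + ev (Θ y₀) (D' (1, 0) (0, v)) =
      a * ev (Θ y₀) v := by
    have h₁ : HasFDerivAt (fun t : ℝ => ev (Θ (Ψ (t, y₀)))) _ 0 :=
      HasFDerivAt.comp (g := fun y => ev (Θ y)) (0 : ℝ) (by rw [hΨy]; exact hT) (hΨ'.comp 0 hl)
    have h₂ : HasFDerivAt (fun t : ℝ => fderiv ℝ Ψ (t, y₀) (0, v)) _ 0 :=
      (hD.comp 0 hl).clm_apply (hasFDerivAt_const _ _)
    have h₃ := (h₁.clm_apply h₂).hasDerivAt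
    have h₄ : HasDerivAt (fun t : ℝ => Real.exp (t * a) * ev (Θ y₀) v)
        (a * ev (Θ y₀) v) 0 := by
      simpa using (((hasDerivAt_id (0 : ℝ)).mul_const a).exp).mul_const (ev (Θ y₀) v)
    have h₅ := h₃.unique (h₄.congr_of_eventuallyEq (by
      filter_upwards [hscale] with t ht
      simpa only [hev] using ht v))
    simp [hid, hΨy] at h₅
    linarith
  have hspace : fderiv ℝ (fun y => Θ y ![fderiv ℝ Ψ (0, y) (1, 0)]) y₀ v =
      T' v (fderiv ℝ Ψ (0, y₀) (1, 0)) + ev (Θ y₀) (D' (0, v) (1, 0)) := by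
    simp only [hev]
    have h₂ : HasFDerivAt (fun y : E => fderiv ℝ Ψ (0, y) (1, 0)) _ y₀ :=
      (hD.comp y₀ hr).clm_apply (hasFDerivAt_const _ _)
    rw [(hT.clm_apply h₂).fderiv]
    simp [add_comm]
  have hext : extDeriv Θ y₀ ![fderiv ℝ Ψ (0, y₀) (1, 0), v] =
      T' (fderiv ℝ Ψ (0, y₀) (1, 0)) v - T' v (fderiv ℝ Ψ (0, y₀) (1, 0)) := by
    rw [extDeriv, ContinuousAlternatingMap.alternatizeUncurryFin_apply, Fin.sum_univ_two]
    have h0 (p q : E) : (0 : Fin 2).removeNth ![p, q] = ![q] := by ext i; fin_cases i; rfl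
    have h1 (p q : E) : (1 : Fin 2).removeNth ![p, q] = ![p] := by ext i; fin_cases i; rfl
    rw [h0, h1, hev, hev]
    simp [hT', sub_eq_add_neg]
  rw [hext, hspace, hev, ← hsymm]
  linarith

end Local

variable {E : Type*} [NormedAddCommGroup E] [NormedSpace ℝ E]
  {M : Type*} [TopologicalSpace M] [ChartedSpace E M]

/-! ### Forms in charts; naturality of the exterior derivative -/

section Chart

variable [IsManifold 𝓘(ℝ, E) ∞ M] {k : ℕ}

theorem contMDiffAt_extChartAt_symm_of_mem_target {x₀ : M} {y : E}
    (hy : y ∈ (extChartAt 𝓘(ℝ, E) x₀).target) :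
    ContMDiffAt 𝓘(ℝ, E) 𝓘(ℝ, E) ∞ (extChartAt 𝓘(ℝ, E) x₀).symm y :=
  (contMDiffOn_extChartAt_symm x₀).contMDiffAt ((isOpen_extChartAt_target x₀).mem_nhds hy)

theorem contMDiffAt_extChartAt_of_mem_source {x₀ x : M}
    (hx : x ∈ (extChartAt 𝓘(ℝ, E) x₀).source) :
    ContMDiffAt 𝓘(ℝ, E) 𝓘(ℝ, E) ∞ (extChartAt 𝓘(ℝ, E) x₀) x :=
  contMDiffAt_extChartAt' (by simpa using hx)

namespace DiffForm

/-- The pullback of a form along a map `h` from a vector space can be computed in any chart. -/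
theorem compContinuousLinearMap_mfderiv_eq_chartRep {V : Type*} [NormedAddCommGroup V]
    [NormedSpace ℝ V] (α : DiffForm E M k) {x₀ : M} {h : V → M} {z : V}
    (hh : MDifferentiableAt 𝓘(ℝ, V) 𝓘(ℝ, E) h z)
    (hz : h z ∈ (extChartAt 𝓘(ℝ, E) x₀).source) :
    ((α (h z)).compContinuousLinearMap (mfderiv 𝓘(ℝ, V) 𝓘(ℝ, E) h z) : V [⋀^Fin k]→L[ℝ] ℝ) =
      (α.chartRep x₀ (extChartAt 𝓘(ℝ, E) x₀ (h z))).compContinuousLinearMap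
        (fderiv ℝ (fun w => extChartAt 𝓘(ℝ, E) x₀ (h w)) z) := by
  set φ := extChartAt 𝓘(ℝ, E) x₀
  have hsymm : MDifferentiableAt 𝓘(ℝ, E) 𝓘(ℝ, E) φ.symm (φ (h z)) :=
    (contMDiffAt_extChartAt_symm_of_mem_target (φ.map_source hz)).mdifferentiableAt (by simp)
  have hφ : MDifferentiableAt 𝓘(ℝ, E) 𝓘(ℝ, E) φ (h z) :=
    (contMDiffAt_extChartAt_of_mem_source hz).mdifferentiableAt (by simp)
  have hφh : MDifferentiableAt 𝓘(ℝ, V) 𝓘(ℝ, E) (fun w => φ (h w)) z := hφ.comp z hh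
  have hev : h =ᶠ[𝓝 z] φ.symm ∘ fun w => φ (h w) := by
    filter_upwards [hh.continuousAt ((isOpen_extChartAt_source x₀).mem_nhds hz)] with w hw
    exact (φ.left_inv hw).symm
  have key : (mfderiv 𝓘(ℝ, V) 𝓘(ℝ, E) h z : V →L[ℝ] E) =
      (mfderiv 𝓘(ℝ, E) 𝓘(ℝ, E) φ.symm (φ (h z)) : E →L[ℝ] E).comp
        (fderiv ℝ (fun w => φ (h w)) z) := by
    have h := hev.mfderiv_eq.trans (mfderiv_comp z hsymm hφh)
    rw [mfderiv_eq_fderiv] at h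
    exact h
  -- Every tangent space is definitionally `E`; the non-dependent type of `A` allows rewriting the
  -- base point.
  let A : M → E [⋀^Fin k]→L[ℝ] ℝ := α
  have hA : A (φ.symm (φ (h z))) = A (h z) := by rw [φ.left_inv hz]
  change (A (h z)).compContinuousLinearMap (mfderiv 𝓘(ℝ, V) 𝓘(ℝ, E) h z : V →L[ℝ] E) =
    ((A (φ.symm (φ (h z)))).compContinuousLinearMap
      (mfderiv 𝓘(ℝ, E) 𝓘(ℝ, E) φ.symm (φ (h z)) : E →L[ℝ] E)).compContinuousLinearMap _
  rw [hA, key]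
  rfl

/-- The expression of a pullback in charts. -/
theorem chartRep_pullback {f : M → M} (hf : ContMDiff 𝓘(ℝ, E) 𝓘(ℝ, E) ∞ f) (α : DiffForm E M k)
    {x₀ x₁ : M} {y : E} (hy : y ∈ (extChartAt 𝓘(ℝ, E) x₀).target)
    (hfy : f ((extChartAt 𝓘(ℝ, E) x₀).symm y) ∈ (extChartAt 𝓘(ℝ, E) x₁).source) :
    (pullback f α).chartRep x₀ y =
      (α.chartRep x₁ (extChartAt 𝓘(ℝ, E) x₁ (f ((extChartAt 𝓘(ℝ, E) x₀).symm y)))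
        ).compContinuousLinearMap
        (fderiv ℝ (fun w => extChartAt 𝓘(ℝ, E) x₁ (f ((extChartAt 𝓘(ℝ, E) x₀).symm w))) y) := by
  have h₁ := (contMDiffAt_extChartAt_symm_of_mem_target hy).mdifferentiableAt (by simp)
  have h₂ := (hf ((extChartAt 𝓘(ℝ, E) x₀).symm y)).mdifferentiableAt (by simp)
  rw [← compContinuousLinearMap_mfderiv_eq_chartRep α
    (h := fun w => f ((extChartAt 𝓘(ℝ, E) x₀).symm w)) (h₂.comp y h₁) hfy]
  rw [show mfderiv 𝓘(ℝ, E) 𝓘(ℝ, E) (fun w => f ((extChartAt 𝓘(ℝ, E) x₀).symm w)) y = _ from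
    mfderiv_comp y h₂ h₁]
  rfl

/-- The tangent space at `x` is identified with `E` by the preferred chart at `x`, so the derivative
of that chart at `x` is the identity. -/
theorem extD_apply (α : DiffForm E M k) (x : M) :
    extD α x = (extDeriv (α.chartRep x) (extChartAt 𝓘(ℝ, E) x x) : E [⋀^Fin (k + 1)]→L[ℝ] ℝ) := by
  unfold extD
  rw [mfderiv_extChartAt_self]
  rfl

omit [IsManifold 𝓘(ℝ, E) ∞ M] in
theorem IsSmooth.differentiableAt_chartRep {α : DiffForm E M k} (hα : α.IsSmooth) {x₀ : M} {y : E}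
    (hy : y ∈ (extChartAt 𝓘(ℝ, E) x₀).target) : DifferentiableAt ℝ (α.chartRep x₀) y :=
  ((hα x₀).contDiffAt ((isOpen_extChartAt_target x₀).mem_nhds hy)).differentiableAt (by simp)

/-- The exterior derivative commutes with pullbacks along smooth maps. -/
theorem extD_pullback {f : M → M} (hf : ContMDiff 𝓘(ℝ, E) 𝓘(ℝ, E) ∞ f) {α : DiffForm E M k}
    (hα : α.IsSmooth) : extD (pullback f α) = pullback f (extD α) := by
  funext x
  set φ := extChartAt 𝓘(ℝ, E) x
  set ψ := extChartAt 𝓘(ℝ, E) (f x)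
  have hx : φ.symm (φ x) = x := extChartAt_to_inv x
  have hy : φ x ∈ φ.target := mem_extChartAt_target x
  have hsymm : ContMDiffAt 𝓘(ℝ, E) 𝓘(ℝ, E) ∞ φ.symm (φ x) :=
    contMDiffAt_extChartAt_symm_of_mem_target hy
  have hfs : ContMDiffAt 𝓘(ℝ, E) 𝓘(ℝ, E) ∞ (fun w => f (φ.symm w)) (φ x) :=
    (hf _).comp (φ x) hsymm
  have hfx : f (φ.symm (φ x)) ∈ ψ.source := by rw [hx]; exact mem_extChartAt_source _
  have hF : ContDiffAt ℝ ∞ (fun w => ψ (f (φ.symm w))) (φ x) :=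
    ((contMDiffAt_extChartAt_of_mem_source hfx).comp (φ x) hfs).contDiffAt
  have hev : (pullback f α).chartRep x =ᶠ[𝓝 (φ x)] fun y =>
      (α.chartRep (f x) (ψ (f (φ.symm y)))).compContinuousLinearMap
        (fderiv ℝ (fun w => ψ (f (φ.symm w))) y) := by
    filter_upwards [(isOpen_extChartAt_target x).mem_nhds hy,
      hfs.continuousAt ((isOpen_extChartAt_source (f x)).mem_nhds hfx)] with y hy₁ hy₂
    exact chartRep_pullback hf α hy₁ hy₂
  have hdiff : DifferentiableAt ℝ (α.chartRep (f x)) (ψ (f (φ.symm (φ x)))) :=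
    hα.differentiableAt_chartRep (ψ.map_source hfx)
  have hd : (mfderiv 𝓘(ℝ, E) 𝓘(ℝ, E) f x : E →L[ℝ] E) =
      fderiv ℝ (fun w => ψ (f (φ.symm w))) (φ x) := by
    refine ((hf x).mdifferentiableAt (by simp)).mfderiv.trans ?_
    simp [writtenInExtChartAt, Function.comp_def, φ, ψ]
    rfl
  have h := extDeriv_pullback (f := fun w => ψ (f (φ.symm w))) (x := φ x) hdiff hF
    (by simpa using WithTop.coe_le_coe.2 (le_top : (2 : ℕ∞) ≤ ⊤))
  rw [extD_apply, hev.extDeriv_eq, h, hx, ← hd]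
  unfold pullback
  rw [extD_apply]
  rfl

theorem extD_smul (a : ℝ) (α : DiffForm E M k) : extD (a • α) = a • extD α := by
  funext x
  rw [extD_apply, show (a • α).chartRep x = a • α.chartRep x from rfl, extDeriv_smul,
    Pi.smul_apply, extD_apply]
  rfl

end DiffForm

end Chart

/-! ### The exponential map, the flow in charts and the generator -/

theorem PosReal.contMDiff_exp : ContMDiff 𝓘(ℝ, ℝ) 𝓘(ℝ, ℝ) ∞ PosReal.exp := by
  intro t
  rw [contMDiffAt_iff_target]
  refine ⟨(Real.continuous_exp.subtype_mk _).continuousAt, ?_⟩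
  -- The chart of `PosReal` is the inclusion into `ℝ`, in which the map reads as `Real.exp`.
  exact Real.contDiff_exp.contMDiff.contMDiffAt

theorem PosReal.exp_zero : PosReal.exp 0 = 1 := Subtype.ext Real.exp_zero

theorem PosReal.exp_zero_mul_smul {X : Type*} [MulAction PosReal X] (ξ : ℝ) (x : X) :
    PosReal.exp (0 * ξ) • x = x := by
  rw [zero_mul, PosReal.exp_zero, one_smul]

section Action

variable [IsManifold 𝓘(ℝ, E) ∞ M] [MulAction PosReal M]
  [ContMDiffSMul 𝓘(ℝ, ℝ) 𝓘(ℝ, E) ∞ PosReal M]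

theorem ScalesForm.extD {k : ℕ} {c : ℝ} {α : DiffForm E M k}
    (h : ScalesForm c α) (hα : α.IsSmooth) : ScalesForm c α.extD := fun g => by
  rw [← DiffForm.extD_pullback
    (ContMDiffSMul.contMDiff_const_smul (I := 𝓘(ℝ, ℝ)) g) hα, h g, DiffForm.extD_smul]

omit [IsManifold 𝓘(ℝ, E) ∞ M] [ContMDiffSMul 𝓘(ℝ, ℝ) 𝓘(ℝ, E) ∞ PosReal M] in
theorem ScalesForm.neg {k : ℕ} {c : ℝ} {α : DiffForm E M k}
    (h : ScalesForm c α) : ScalesForm c (-α) := fun g => by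
  rw [smul_neg, ← h g]
  rfl

variable (E) in
/-- The flow `(t, y) ↦ Φ_{exp(tξ)} y` in the chart at `x₀`. -/
def chartFlow (ξ : ℝ) (x₀ : M) (p : ℝ × E) : E :=
  extChartAt 𝓘(ℝ, E) x₀ (PosReal.exp (p.1 * ξ) • (extChartAt 𝓘(ℝ, E) x₀).symm p.2)

omit [IsManifold 𝓘(ℝ, E) ∞ M] in
theorem contMDiff_orbit (ξ : ℝ) (x : M) :
    ContMDiff 𝓘(ℝ, ℝ) 𝓘(ℝ, E) ∞ (fun t : ℝ => PosReal.exp (t * ξ) • x) :=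
  (PosReal.contMDiff_exp.comp (contDiff_id.mul contDiff_const).contMDiff).smul contMDiff_const

theorem contMDiffAt_flow (ξ : ℝ) {x₀ : M} (t : ℝ) {y : E}
    (hy : y ∈ (extChartAt 𝓘(ℝ, E) x₀).target) :
    ContMDiffAt 𝓘(ℝ, ℝ × E) 𝓘(ℝ, E) ∞
      (fun p : ℝ × E => PosReal.exp (p.1 * ξ) • (extChartAt 𝓘(ℝ, E) x₀).symm p.2) (t, y) := by
  have h₁ : ContMDiff 𝓘(ℝ, ℝ × E) 𝓘(ℝ, ℝ) ∞ (fun p : ℝ × E => PosReal.exp (p.1 * ξ)) :=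
    PosReal.contMDiff_exp.comp (contDiff_fst.mul contDiff_const).contMDiff
  have h₂ : ContMDiffAt 𝓘(ℝ, ℝ × E) 𝓘(ℝ, E) ∞
      (fun p : ℝ × E => (extChartAt 𝓘(ℝ, E) x₀).symm p.2) (t, y) :=
    ContMDiffAt.comp (t, y) (contMDiffAt_extChartAt_symm_of_mem_target hy)
      contDiff_snd.contMDiff.contMDiffAt
  exact h₁.contMDiffAt.smul h₂

/-- The chart is only meaningful on its source, hence the condition `ht` that the moved point has
not left it. -/
theorem contDiffAt_chartFlow (ξ : ℝ) {x₀ : M} {t : ℝ} {y : E}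
    (hy : y ∈ (extChartAt 𝓘(ℝ, E) x₀).target)
    (ht : PosReal.exp (t * ξ) • (extChartAt 𝓘(ℝ, E) x₀).symm y ∈
      (extChartAt 𝓘(ℝ, E) x₀).source) :
    ContDiffAt ℝ ∞ (chartFlow E ξ x₀) (t, y) :=
  (ContMDiffAt.comp (t, y) (contMDiffAt_extChartAt_of_mem_source ht)
    (contMDiffAt_flow ξ t hy)).contDiffAt

omit [IsManifold 𝓘(ℝ, E) ∞ M] [ContMDiffSMul 𝓘(ℝ, ℝ) 𝓘(ℝ, E) ∞ PosReal M] in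
theorem chartFlow_zero (ξ : ℝ) {x₀ : M} {y : E} (hy : y ∈ (extChartAt 𝓘(ℝ, E) x₀).target) :
    chartFlow E ξ x₀ (0, y) = y := by
  simp only [chartFlow, PosReal.exp_zero_mul_smul]
  exact (extChartAt 𝓘(ℝ, E) x₀).right_inv hy

theorem contDiffAt_chartFlow_zero (ξ : ℝ) {x₀ : M} {y : E}
    (hy : y ∈ (extChartAt 𝓘(ℝ, E) x₀).target) : ContDiffAt ℝ ∞ (chartFlow E ξ x₀) (0, y) :=
  contDiffAt_chartFlow ξ hy (by
    rw [PosReal.exp_zero_mul_smul]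
    exact (extChartAt 𝓘(ℝ, E) x₀).map_target hy)

theorem hasFDerivAt_chartFlow_orbit (ξ : ℝ) {x₀ : M} {y : E}
    (hy : y ∈ (extChartAt 𝓘(ℝ, E) x₀).target) :
    HasFDerivAt (fun t : ℝ => chartFlow E ξ x₀ (t, y))
      ((fderiv ℝ (chartFlow E ξ x₀) (0, y)).comp (ContinuousLinearMap.inl ℝ ℝ E)) 0 :=
  HasFDerivAt.comp (g := chartFlow E ξ x₀) (f := fun t : ℝ => (t, y)) (0 : ℝ)
    ((contDiffAt_chartFlow_zero ξ hy).differentiableAt (by simp)).hasFDerivAt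
    (hasFDerivAt_prodMk_left (0 : ℝ) y)

omit [IsManifold 𝓘(ℝ, E) ∞ M] in
/-- The generator is linear in the Lie algebra element. -/
theorem infinitesimalGenerator_eq_smul (ξ : ℝ) (x : M) :
    infinitesimalGenerator E ξ x = ξ • infinitesimalGenerator E 1 x := by
  have h₁ : DifferentiableAt ℝ (fun τ : ℝ => τ * ξ) 0 := differentiableAt_id.mul_const ξ
  have h₂ := ((contMDiff_orbit (E := E) 1 x) 0).mdifferentiableAt (by simp)
  have h₃ := mfderiv_comp_apply_of_eq _ h₂ h₁.mdifferentiableAt (zero_mul ξ) (1 : ℝ)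
  -- The orbit for `ξ` is the orbit for `1` reparametrised by `τ ↦ τ * ξ`; the chain rule gives the
  -- factor `ξ`.
  have h₄ : (fun τ : ℝ => PosReal.exp (τ * ξ) • x) =
      (fun t : ℝ => PosReal.exp (t * 1) • x) ∘ fun τ : ℝ => τ * ξ := by
    funext τ
    simp
  have h₅ : (mfderiv 𝓘(ℝ, ℝ) 𝓘(ℝ, ℝ) (fun τ : ℝ => τ * ξ) 0 : ℝ →L[ℝ] ℝ) (1 : ℝ) =
      ξ • (1 : ℝ) := by
    rw [mfderiv_eq_fderiv]
    have h := (hasDerivAt_mul_const (x := (0 : ℝ)) ξ).deriv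
    rw [← fderiv_apply_one_eq_deriv] at h
    exact h.trans (mul_one ξ).symm
  have h₆ : infinitesimalGenerator E ξ x =
      (mfderiv 𝓘(ℝ, ℝ) 𝓘(ℝ, E) (fun t : ℝ => PosReal.exp (t * 1) • x) 0 : ℝ →L[ℝ] E)
        ((mfderiv 𝓘(ℝ, ℝ) 𝓘(ℝ, ℝ) (fun τ : ℝ => τ * ξ) 0 : ℝ →L[ℝ] ℝ) (1 : ℝ)) := by
    rw [← h₄] at h₃
    exact h₃
  rw [h₆, h₅]
  exact ContinuousLinearMap.map_smul
    (mfderiv 𝓘(ℝ, ℝ) 𝓘(ℝ, E) (fun t : ℝ => PosReal.exp (t * 1) • x) 0 : ℝ →L[ℝ] E) ξ (1 : ℝ)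

/-- The generator in the chart at the base point. -/
theorem infinitesimalGenerator_eq_fderiv (ξ : ℝ) (x : M) :
    infinitesimalGenerator E ξ x =
      fderiv ℝ (chartFlow E ξ x) (0, extChartAt 𝓘(ℝ, E) x x) (1, 0) := by
  have h₁ := ((contMDiff_orbit (E := E) ξ x) 0).mdifferentiableAt (by simp)
  have h₂ : MDifferentiableAt 𝓘(ℝ, E) 𝓘(ℝ, E) (extChartAt 𝓘(ℝ, E) x) x :=
    (contMDiffAt_extChartAt (n := ∞)).mdifferentiableAt (by simp)
  have h₃ := mfderiv_comp_apply_of_eq _ h₂ h₁ (PosReal.exp_zero_mul_smul ξ x) (1 : ℝ)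
  have h₄ := hasFDerivAt_chartFlow_orbit ξ (mem_extChartAt_target (I := 𝓘(ℝ, E)) x)
  simp only [chartFlow, extChartAt_to_inv] at h₄
  rw [mfderiv_extChartAt_self] at h₃
  have h₅ := congrArg (fun A : ℝ →L[ℝ] E => A 1) h₄.hasMFDerivAt.mfderiv
  have h₆ := h₃.symm.trans h₅
  simpa [chartFlow] using! h₆

/-- The contraction of a `1`-form with the generator, in a chart. -/
theorem interior_infinitesimalGenerator_chart (α : DiffForm E M 1) (ξ : ℝ) {x₀ : M} {y : E}
    (hy : y ∈ (extChartAt 𝓘(ℝ, E) x₀).target) :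
    (DiffForm.interior (infinitesimalGenerator E ξ) α).toFun ((extChartAt 𝓘(ℝ, E) x₀).symm y) =
      α.chartRep x₀ y ![fderiv ℝ (chartFlow E ξ x₀) (0, y) (1, 0)] := by
  set p := (extChartAt 𝓘(ℝ, E) x₀).symm y with hp
  have h₁ := ((contMDiff_orbit (E := E) ξ p) 0).mdifferentiableAt (by simp)
  have h₀ : PosReal.exp (0 * ξ) • p = p := PosReal.exp_zero_mul_smul ξ p
  have hps : p ∈ (extChartAt 𝓘(ℝ, E) x₀).source := (extChartAt 𝓘(ℝ, E) x₀).map_target hy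
  -- Pull `α` back along the orbit of `p`, a curve from `ℝ`, and evaluate at the unit vector.
  have h₂ := DiffForm.compContinuousLinearMap_mfderiv_eq_chartRep α (x₀ := x₀) h₁
    (by rw [h₀]; exact hps)
  have h₃ := congrArg (fun β : ℝ [⋀^Fin 1]→L[ℝ] ℝ => β ![1]) h₂
  have h₄ := (hasFDerivAt_chartFlow_orbit ξ hy).fderiv
  simp only [chartFlow, ← hp] at h₄
  let A : M → E [⋀^Fin 1]→L[ℝ] ℝ := α
  have hvec (B : ℝ →L[ℝ] E) : B ∘ ![(1 : ℝ)] = ![B 1] := by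
    ext i
    simp
  have h₅ : A (PosReal.exp (0 * ξ) • p) ![infinitesimalGenerator E ξ p] =
      α.chartRep x₀ (extChartAt 𝓘(ℝ, E) x₀ (PosReal.exp (0 * ξ) • p))
        ![fderiv ℝ (fun w : ℝ => extChartAt 𝓘(ℝ, E) x₀ (PosReal.exp (w * ξ) • p)) 0 1] := by
    rw [← hvec, ← ContinuousAlternatingMap.compContinuousLinearMap_apply, ← h₃]
    exact congrArg (A (PosReal.exp (0 * ξ) • p)) (hvec _).symm
  rw [h₀, h₄, (extChartAt 𝓘(ℝ, E) x₀).right_inv hy] at h₅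
  exact h₅

/-- In a chart the contraction pairs the smooth covector field of `α` with the time derivative of
the flow at `t = 0`, which is smooth in `y`. With `ξ = 1` this is the smoothness of `J`. -/
theorem contMDiff_interior_infinitesimalGenerator {α : DiffForm E M 1} (hα : α.IsSmooth) (ξ : ℝ) :
    ContMDiff 𝓘(ℝ, E) 𝓘(ℝ, ℝ) ∞ (DiffForm.interior (infinitesimalGenerator E ξ) α).toFun := by
  intro x
  have hy := mem_extChartAt_target (I := 𝓘(ℝ, E)) x
  set φ := extChartAt 𝓘(ℝ, E) x
  have hα' : ContDiffAt ℝ ∞ (α.chartRep x) (φ x) :=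
    (hα x).contDiffAt ((isOpen_extChartAt_target x).mem_nhds hy)
  have hX : ContDiffAt ℝ ∞ (fun y => fderiv ℝ (chartFlow E ξ x) (0, y) (1, 0)) (φ x) := by
    have h₁ : ContDiffAt ℝ ∞ (fderiv ℝ (chartFlow E ξ x)) (0, φ x) :=
      (contDiffAt_chartFlow_zero ξ hy).fderiv_right (by simp)
    have h₂ : ContDiffAt ℝ ∞ (fun y : E => ((0 : ℝ), y)) (φ x) := by fun_prop
    exact (ContDiffAt.comp (φ x) h₁ h₂).clm_apply contDiffAt_const
  have h₃ : ContDiffAt ℝ ∞ (fun y => α.chartRep x y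
      ![fderiv ℝ (chartFlow E ξ x) (0, y) (1, 0)]) (φ x) := by
    have h₄ := (((ContinuousAlternatingMap.ofSubsingletonLIE (𝕜 := ℝ) (E := E) (F := ℝ)
      (0 : Fin 1)).symm.contDiff.contDiffAt (n := ∞)).comp (φ x) hα').clm_apply hX
    refine h₄.congr_of_eventuallyEq (Filter.Eventually.of_forall fun y => ?_)
    change _ = α.chartRep x y (fun _ => fderiv ℝ (chartFlow E ξ x) (0, y) (1, 0))
    refine congrArg (α.chartRep x y) (funext fun i => ?_)
    simp
  refine (h₃.contMDiffAt.comp x contMDiffAt_extChartAt).congr_of_eventuallyEq ?_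
  filter_upwards [(isOpen_extChartAt_source (I := 𝓘(ℝ, E)) x).mem_nhds
    (mem_extChartAt_source x)] with z hz
  rw [Function.comp_apply, ← interior_infinitesimalGenerator_chart α ξ (φ.map_source hz),
    φ.left_inv hz]

omit [MulAction PosReal M] [ContMDiffSMul 𝓘(ℝ, ℝ) 𝓘(ℝ, E) ∞ PosReal M] in
theorem DiffForm.chartRep_self {k : ℕ} (α : DiffForm E M k) (x : M) :
    α.chartRep x (extChartAt 𝓘(ℝ, E) x x) = (α x : E [⋀^Fin k]→L[ℝ] ℝ) := by
  have h := mfderivWithin_range_extChartAt_symm (I := 𝓘(ℝ, E)) (x := x)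
  rw [modelWithCornersSelf_coe, Set.range_id, mfderivWithin_univ] at h
  unfold DiffForm.chartRep
  rw [h]
  let A : M → E [⋀^Fin k]→L[ℝ] ℝ := α
  have hA : A ((extChartAt 𝓘(ℝ, E) x).symm (extChartAt 𝓘(ℝ, E) x x)) = A x := by
    rw [extChartAt_to_inv]
  exact hA

/-- Supplies `hscale` of the local Cartan formula with `a = c * ξ`: the pullback is written using
the chart at `x` on both sides, and `(e^{tξ})^c = e^{tcξ}`. -/
theorem ScalesForm.chartRep {c : ℝ} {α : DiffForm E M 1} (h : ScalesForm c α) (ξ : ℝ) {x : M}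
    {t : ℝ} {y : E} (hy : y ∈ (extChartAt 𝓘(ℝ, E) x).target)
    (ht : PosReal.exp (t * ξ) • (extChartAt 𝓘(ℝ, E) x).symm y ∈ (extChartAt 𝓘(ℝ, E) x).source)
    (v : E) :
    α.chartRep x (chartFlow E ξ x (t, y)) ![fderiv ℝ (chartFlow E ξ x) (t, y) (0, v)] =
      Real.exp (t * (c * ξ)) * α.chartRep x y ![v] := by
  have h₁ := DiffForm.chartRep_pullback
    (ContMDiffSMul.contMDiff_const_smul (I := 𝓘(ℝ, ℝ)) (PosReal.exp (t * ξ))) α hy ht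
  rw [h (PosReal.exp (t * ξ))] at h₁
  have h₂ : HasFDerivAt (fun w : E => chartFlow E ξ x (t, w)) _ y :=
    HasFDerivAt.comp (g := chartFlow E ξ x) (f := fun w : E => (t, w)) y
      ((contDiffAt_chartFlow ξ hy ht).differentiableAt (by simp)).hasFDerivAt
      (hasFDerivAt_prodMk_right t y)
  have h₃ := h₂.fderiv
  simp only [chartFlow] at h₃
  rw [h₃] at h₁
  have h₄ := congrArg (fun β : E [⋀^Fin 1]→L[ℝ] ℝ => β ![v]) h₁
  have hexp : ((PosReal.exp (t * ξ) : PosReal) : ℝ) ^ c = Real.exp (t * (c * ξ)) := by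
    change Real.exp (t * ξ) ^ c = _
    rw [← Real.exp_mul]
    ring_nf
  rw [← hexp]
  refine Eq.trans ?_ h₄.symm
  change _ = α.chartRep x (chartFlow E ξ x (t, y)) _
  congr 1
  ext i
  simp

/-- Cartan's formula for a `1`-form scaled by the action. -/
theorem ScalesForm.cartan {c : ℝ} {α : DiffForm E M 1} (h : ScalesForm c α) (hα : α.IsSmooth)
    (ξ : ℝ) :
    DiffForm.interior (infinitesimalGenerator E ξ) α.extD +
      DiffForm.differential (DiffForm.interior (infinitesimalGenerator E ξ) α).toFun =
      (c * ξ) • α := by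
  funext x
  have hy := mem_extChartAt_target (I := 𝓘(ℝ, E)) x
  set φ := extChartAt 𝓘(ℝ, E) x with hφ
  have htarget : ∀ᶠ y in 𝓝 (φ x), y ∈ φ.target := (isOpen_extChartAt_target x).mem_nhds hy
  -- By continuity the orbit stays in the chart domain for small `t`, which is all the local formula
  -- requires.
  have hflow : ∀ᶠ t in 𝓝 (0 : ℝ), PosReal.exp (t * ξ) • φ.symm (φ x) ∈ φ.source := by
    refine (contMDiff_orbit (E := E) ξ (φ.symm (φ x))).continuous.continuousAt
      ((isOpen_extChartAt_source x).mem_nhds ?_)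
    rw [PosReal.exp_zero_mul_smul]
    exact φ.map_target hy
  have hloc (v : E) := extDeriv_add_fderiv_of_scaling (hα.differentiableAt_chartRep hy)
    ((contDiffAt_chartFlow_zero ξ hy).of_le (WithTop.coe_le_coe.2 (le_top : (2 : ℕ∞) ≤ ⊤)))
    (htarget.mono fun y hy => chartFlow_zero ξ hy)
    (hflow.mono fun t ht => h.chartRep ξ hy ht) v
  rw [← infinitesimalGenerator_eq_fderiv, DiffForm.chartRep_self] at hloc
  have hd : (mfderiv 𝓘(ℝ, E) 𝓘(ℝ, ℝ)
      (DiffForm.interior (infinitesimalGenerator E ξ) α).toFun x : E →L[ℝ] ℝ) =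
      fderiv ℝ (fun y => α.chartRep x y
        ![fderiv ℝ (chartFlow E ξ x) (0, y) (1, 0)]) (φ x) := by
    refine ((contMDiff_interior_infinitesimalGenerator hα ξ x).mdifferentiableAt
      (by simp)).mfderiv.trans ?_
    rw [modelWithCornersSelf_coe, Set.range_id, fderivWithin_univ]
    refine Filter.EventuallyEq.fderiv_eq (htarget.mono fun y hy => ?_)
    exact interior_infinitesimalGenerator_chart α ξ hy
  refine ContinuousAlternatingMap.ext fun v => ?_
  obtain ⟨w, rfl⟩ : ∃ w : E, v = ![w] := ⟨v 0, by ext i; fin_cases i; rfl⟩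
  refine Eq.trans ?_ (hloc w)
  rw [← hd, ← DiffForm.extD_apply]
  rfl

end Action

end

/-! ### The momentum map -/

theorem mainTheorem6 {E : Type*} [NormedAddCommGroup E] [NormedSpace ℝ E] [FiniteDimensional ℝ E]
    {M : Type*} [TopologicalSpace M] [ChartedSpace E M] [IsManifold 𝓘(ℝ, E) ∞ M]
    (Ω : DiffForm E M 2) (θ : DiffForm E M 1) (hM : IsExactSymplectic Ω θ)
    [MulAction PosReal M] [ContMDiffSMul 𝓘(ℝ, ℝ) 𝓘(ℝ, E) ∞ PosReal M]
    (c : ℝ) (hθ : ScalesForm c θ) :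
    ∃ J : M → ℝ,
      (∀ ξ : ℝ, momentumFunction J ξ =
        (DiffForm.interior (infinitesimalGenerator E ξ) θ).toFun) ∧
      IsConformalMomentumMap c Ω θ J := by
  have hJ (ξ : ℝ) : momentumFunction
      (DiffForm.interior (infinitesimalGenerator E 1) θ).toFun ξ =
        (DiffForm.interior (infinitesimalGenerator E ξ) θ).toFun := by
    funext x
    simp only [momentumFunction, DiffForm.toFun, DiffForm.interior_apply]
    rw [infinitesimalGenerator_eq_smul ξ x]
    exact ((θ x).map_vecCons_smul ![] ξ (infinitesimalGenerator E 1 x)).symm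
  refine ⟨_, hJ, ?_, contMDiff_interior_infinitesimalGenerator hM.smooth_primitive 1, fun ξ => ?_⟩
  · rw [hM.eq_neg_extD]
    exact (hθ.extD hM.smooth_primitive).neg
  -- Replacing `(c * ξ) • θ` by Cartan's formula, the two contractions of `dθ` cancel and `dJ_ξ`
  -- remains.
  · rw [hJ, ← hθ.cartan hM.smooth_primitive ξ, hM.eq_neg_extD]
    have hneg : DiffForm.interior (infinitesimalGenerator E ξ) (-θ.extD) =
        -DiffForm.interior (infinitesimalGenerator E ξ) θ.extD := rfl
    rw [hneg, neg_add_cancel_left]
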